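/- Let $X$ be an infinite dimensional complex Banach space and let $S,T$ be bounded linear operators on $X$. Suppose that $T$ has the single valued extension property (for every open $U\subseteq\mathbb{C}$, the only analytic $f:U\to X$ with $(T-\lambda)f(\lambda)=0$ for all $\lambda\in U$ is $f=0$), and that $S$ is a quasiaffine transform of $T$: there is a bounded linear operator $A$ on $X$ with trivial kernel and dense range such that $AS=TA$. For a bounded linear operator $R$ on $X$ write $N(R)$ for its null space, $\mathcal{R}(R)$ for its range, $\alpha(R)=\dim N(R)$ and $\beta(R)=\dim X/\mathcal{R}(R)$, and put $$\sigma_a(R)=\{\lambda\in\mathbb{C}:\mathcal{R}(R-\lambda)\text{ is not closed or }\alpha(R-\lambda)>0\},$$ $$\sigma_{ea}(R)=\mathbb{C}\setminus\{\lambda\in\mathbb{C}:\mathcal{R}(R-\lambda)\text{ is closed},\ \alpha(R-\lambda)<\infty,\ \alpha(R-\lambda)-\beta(R-\lambda)\le 0\},$$ $$\sigma_{ab}(R)=\bigcap\{\sigma_a(R+K):K\text{ a compact operator on }X,\ RK=KR\},$$ $$\pi_{00}^a(R)=\{\lambda:\lambda\text{ is an isolated point of }\sigma_a(R),\ 0<\alpha(R-\lambda)<\infty\},$$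 and let the reduced minimum modulus of $R$ be $$\gamma_R(\zeta)=\inf\left\{\frac{\|(R-\zeta)x\|}{\operatorname{dist}(x,N(R-\zeta))}:x\in X\setminus N(R-\zeta)\right\}\in[0,\infty]\qquad(\zeta\in\mathbb{C}),$$ where $\inf\emptyset=\infty$. We say that $a$-Weyl's theorem holds for $R$ if $\sigma_a(R)\setminus\sigma_{ea}(R)=\pi_{00}^a(R)$. Then the following statements are equivalent: (i) $a$-Weyl's theorem holds for $S$; (ii) $\mathcal{R}(S-\lambda)$ is closed for every $\lambda\in\pi_{00}^a(S)$; (iii) the function $\gamma_S:\mathbb{C}\to[0,\infty]$ is discontinuous at every point of $\pi_{00}^a(S)$; (iv) $\sigma_{ea}(S)\cap\pi_{00}^a(S)=\emptyset$; (v) $\pi_{00}^a(S)=\sigma_a(S)\setminus\sigma_{ab}(S)$. -/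

import Mathlib

open scoped ENNReal

noncomputable section

namespace OperatorSpectra

variable {X : Type*} [NormedAddCommGroup X] [NormedSpace ℂ X]

/-- The operator `T - z`, that is `T - z I`. -/
def shift (T : X →L[ℂ] X) (z : ℂ) : X →L[ℂ] X :=
  T - z • ContinuousLinearMap.id ℂ X

/-- The null space `N(T)`. -/
def nullSpace (T : X →L[ℂ] X) : Submodule ℂ X :=
  LinearMap.ker (T : X →ₗ[ℂ] X)

/-- The range `R(T)`. -/
def rangeSpace (T : X →L[ℂ] X) : Submodule ℂ X :=
  LinearMap.range (T : X →ₗ[ℂ] X)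

/-- The range `R(T)` is closed. -/
def HasClosedRange (T : X →L[ℂ] X) : Prop :=
  IsClosed (rangeSpace T : Set X)

/-- `α(T) = dim N(T)`, with value `⊤` when `N(T)` is infinite dimensional. -/
def nullity (T : X →L[ℂ] X) : ℕ∞ :=
  Cardinal.toENat (Module.rank ℂ (nullSpace T))

/-- `β(T) = dim X / R(T)`, with value `⊤` when it is infinite. -/
def defect (T : X →L[ℂ] X) : ℕ∞ :=
  Cardinal.toENat (Module.rank ℂ (X ⧸ rangeSpace T))

/-- The index `i(T) = α(T) - β(T)`, an extended real number; it is used only when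
`α(T)` is finite, and is then an integer or `-∞`. -/
def index (T : X →L[ℂ] X) : EReal :=
  ((nullity T : ℝ≥0∞) : EReal) - ((defect T : ℝ≥0∞) : EReal)

/-- The class `Φ₊(X)` of upper semi-Fredholm operators. -/
def PhiPlus (T : X →L[ℂ] X) : Prop :=
  HasClosedRange T ∧ nullity T < ⊤

/-- The class `Φ₊⁻(X)` of upper semi-Fredholm operators of nonpositive index. -/
def PhiPlusMinus (T : X →L[ℂ] X) : Prop :=
  PhiPlus T ∧ index T ≤ 0

/-- The approximate point spectrum `σ_a(T)`. -/
def sigmaA (T : X →L[ℂ] X) : Set ℂ :=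
  {z | ¬ HasClosedRange (shift T z) ∨ 0 < nullity (shift T z)}

/-- The essential approximate point spectrum `σ_ea(T)`. -/
def sigmaEA (T : X →L[ℂ] X) : Set ℂ :=
  {z | ¬ PhiPlusMinus (shift T z)}

/-- The Browder essential approximate point spectrum `σ_ab(T)`: the intersection of
`σ_a(T + K)` over all compact operators `K` commuting with `T`. -/
def sigmaAB (T : X →L[ℂ] X) : Set ℂ :=
  {z | ∀ K : X →L[ℂ] X, IsCompactOperator K → T.comp K = K.comp T → z ∈ sigmaA (T + K)}

/-- `iso K = K \ acc K`, the isolated points of a set `K` of complex numbers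
(`derivedSet K` is the set of its accumulation points). -/
def iso (K : Set ℂ) : Set ℂ :=
  K \ derivedSet K

/-- `π₀₀^a(T)`: the eigenvalues of finite multiplicity that are isolated in `σ_a(T)`. -/
def piA (T : X →L[ℂ] X) : Set ℂ :=
  {z | z ∈ iso (sigmaA T) ∧ 0 < nullity (shift T z) ∧ nullity (shift T z) < ⊤}

/-- `a`-Weyl's theorem holds for `T`. -/
def AWeyl (T : X →L[ℂ] X) : Prop :=
  sigmaA T \ sigmaEA T = piA T

/-- The reduced minimum modulus `γ_T(z)`: the infimum of
`‖(T - z) x‖ / dist (x, N(T - z))` over all `x ∉ N(T - z)`. It takes values in `[0, ∞]`,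
and is `∞` (an infimum over the empty set) only when `T - z = 0`. -/
def gamma (T : X →L[ℂ] X) (z : ℂ) : ℝ≥0∞ :=
  ⨅ (x : X) (_ : x ∉ nullSpace (shift T z)),
    ENNReal.ofReal (‖shift T z x‖ / Metric.infDist x (nullSpace (shift T z) : Set X))

/-- The single valued extension property: on every open set `U`, the only analytic solution
of `(T - z) f(z) = 0` is the zero function. -/
def SVEP (T : X →L[ℂ] X) : Prop :=
  ∀ U : Set ℂ, IsOpen U → ∀ f : ℂ → X, AnalyticOnNhd ℂ f U →
    (∀ z ∈ U, shift T z (f z) = 0) → ∀ z ∈ U, f z = 0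

/-- A quasiaffinity: a bounded operator with trivial kernel and dense range. -/
def Quasiaffinity (A : X →L[ℂ] X) : Prop :=
  nullSpace A = ⊥ ∧ Dense (rangeSpace A : Set X)

/-- `S ≺ T`: `S` is a quasiaffine transform of `T`. -/
def QuasiaffineTransform (S T : X →L[ℂ] X) : Prop :=
  ∃ A : X →L[ℂ] X, Quasiaffinity A ∧ A.comp S = T.comp A

end OperatorSpectra

end

noncomputable section

open Filter Topology

namespace OperatorSpectra


/-! ### Operators bounded below modulo a compact operator -/

section Estimates

variable {E F G : Type*} [NormedAddCommGroup E] [NormedSpace ℂ E] [NormedAddCommGroup F]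
  [NormedSpace ℂ F] [NormedAddCommGroup G] [NormedSpace ℂ G]

/-! Since `A` is injective, it carries a nonzero local analytic eigenvector function of `S` to one
of `T`; so `S` inherits the single valued extension property, and nothing else about `T` is needed.

The core is `PhiPlus.of_mem_sigmaA_of_sVEP`: if `z` lies in `σ_a(S)` and `B = S - z` is upper
semi-Fredholm, then `z` is in `π₀₀^a(S)` and outside both `σ_ea(S)` and `σ_ab(S)`. Indeed the spaces
`N(B) ∩ R(B ^ k)` stabilise, and a nonzero vector in all of them would be the value at `z` of an
analytic eigenvector function (`PhiPlus.exists_analytic_eigenvector`). Hence `N(B) ∩ R(B ^ p) = 0`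
for some `p`, so `B` has finite ascent. This yields `α(B) ≤ β(B)`, and also a compact `K` commuting
with `B`, with `B ^ p K = 0` and `K = 1` on `N(B)`. Then `B + K` is bounded below, which removes `z`
from `σ_ab(S)` and isolates it in `σ_a(S)`.

Thus (i), (iv) and (v) each amount to closedness of `R(S - z)` on `π₀₀^a(S)`. For (iii), an
eigenvector at `z` gives `γ_S(w) ≤ |w - z|` for nearby `w ≠ z`, so continuity at `z` means `γ_S(z) =
0`, that is, a range that is not closed. -/

theorem isClosedEmbedding_of_bound [CompleteSpace E] (T : E →L[ℂ] F) {C : ℝ}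
    (h : ∀ x, ‖x‖ ≤ C * ‖T x‖) : IsClosedEmbedding T := by
  have h1 : AntilipschitzWith (Real.toNNReal C) T := by
    refine ContinuousLinearMap.antilipschitz_of_bound T fun x => (h x).trans ?_
    gcongr
    exact Real.le_coe_toNNReal C
  exact h1.isClosedEmbedding T.uniformContinuous

theorem norm_le_prod_of_estimate {T : E →L[ℂ] F} {K : E →L[ℂ] G} {C : ℝ}
    (h : ∀ x, ‖x‖ ≤ C * ‖T x‖ + ‖K x‖) (x : E) : ‖x‖ ≤ (|C| + 1) * ‖T.prod K x‖ := by
  have h1 : ‖T x‖ ≤ ‖T.prod K x‖ := le_max_left _ _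
  have h2 : ‖K x‖ ≤ ‖T.prod K x‖ := le_max_right _ _
  calc ‖x‖ ≤ C * ‖T x‖ + ‖K x‖ := h x
    _ ≤ |C| * ‖T x‖ + ‖K x‖ := by gcongr; exact le_abs_self C
    _ ≤ |C| * ‖T.prod K x‖ + ‖T.prod K x‖ := by gcongr
    _ = _ := by ring

theorem exists_bound_of_injective_of_estimate [CompleteSpace E] (T : E →L[ℂ] F) (K : E →L[ℂ] G)
    (hK : IsCompactOperator K) {C : ℝ} (h : ∀ x, ‖x‖ ≤ C * ‖T x‖ + ‖K x‖)
    (hinj : ∀ x, T x = 0 → x = 0) : ∃ C' : ℝ, ∀ x, ‖x‖ ≤ C' * ‖T x‖ := by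
  by_contra! hcon
  choose x hx using fun n : ℕ => hcon (n + 1)
  have hx0 : ∀ n, 0 < ‖x n‖ := fun n =>
    lt_of_le_of_lt (by positivity) (hx n)
  let y : ℕ → E := fun n => ((‖x n‖⁻¹ : ℝ) : ℂ) • x n
  have hy1 : ∀ n, ‖y n‖ = 1 := fun n => by
    simp [y, norm_smul, (hx0 n).ne']
  have hTy : ∀ n, ‖T (y n)‖ ≤ 1 / ((n : ℝ) + 1) := fun n => by
    simp only [y, map_smul, norm_smul, Complex.norm_real, norm_inv, norm_norm]
    rw [inv_mul_le_iff₀ (hx0 n), mul_one_div, le_div_iff₀ (by positivity)]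
    linarith [hx n]
  have hT0 : Tendsto (fun n => T (y n)) atTop (𝓝 0) :=
    squeeze_zero_norm hTy tendsto_one_div_add_atTop_nhds_zero_nat
  obtain ⟨A, hA, hAK⟩ := IsCompactOperator.image_closedBall_subset_compact (f := K.toLinearMap) hK 1
  obtain ⟨k, -, φ, hφ, hk⟩ := hA.tendsto_subseq (x := fun n => K (y n))
    (fun n => hAK ⟨y n, by simp [hy1 n], rfl⟩)
  -- The pair `(T, K)` is a closed embedding, so convergence of `T y` and `K y` along a subsequence
  -- forces convergence of `y`, to a unit vector killed by `T`.
  have hemb := isClosedEmbedding_of_bound (T.prod K) (norm_le_prod_of_estimate h)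
  have hlim : Tendsto (fun n => T.prod K (y (φ n))) atTop (𝓝 (0, k)) :=
    (hT0.comp hφ.tendsto_atTop).prodMk_nhds hk
  obtain ⟨z, hz⟩ := hemb.isClosed_range.mem_of_tendsto hlim
    (Eventually.of_forall fun n => Set.mem_range_self _)
  rw [← hz] at hlim
  have hyz : Tendsto (fun n => y (φ n)) atTop (𝓝 z) := hemb.tendsto_nhds_iff.2 hlim
  have hz1 : ‖z‖ = 1 := by
    refine tendsto_nhds_unique hyz.norm ?_
    simp [hy1]
  have : z = 0 := hinj z (congrArg Prod.fst hz)
  simp [this] at hz1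

/-- On the kernel the estimate makes `K` itself bounded below; being compact as well, it forces the
unit ball there to be compact. -/
theorem finiteDimensional_ker_of_estimate [CompleteSpace E] (T : E →L[ℂ] F) (K : E →L[ℂ] G)
    (hK : IsCompactOperator K) {C : ℝ} (h : ∀ x, ‖x‖ ≤ C * ‖T x‖ + ‖K x‖) :
    FiniteDimensional ℂ (LinearMap.ker (T : E →ₗ[ℂ] F)) := by
  set N := LinearMap.ker (T : E →ₗ[ℂ] F)
  have hN : IsClosed (N : Set E) := T.isClosed_ker
  have : CompleteSpace N := hN.completeSpace_coe
  have hKN : IsCompactOperator (K.comp N.subtypeL) := hK.comp_clm N.subtypeL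
  have hemb : IsClosedEmbedding (K.comp N.subtypeL) :=
    isClosedEmbedding_of_bound (C := 1) _ fun x => by
      have := h x
      rw [show T x = 0 from x.2] at this
      simpa using this
  obtain ⟨A, hA, hAK⟩ := IsCompactOperator.image_closedBall_subset_compact
    (f := (K.comp N.subtypeL).toLinearMap) hKN 1
  refine FiniteDimensional.of_isCompact_closedBall ℂ (r := 1) one_pos (c := (0 : N)) ?_
  exact (hemb.isCompact_preimage hA).of_isClosed_subset Metric.isClosed_closedBall
    (Set.image_subset_iff.1 hAK)

theorem isClosed_range_of_estimate [CompleteSpace E] (T : E →L[ℂ] F) (K : E →L[ℂ] G)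
    (hK : IsCompactOperator K) {C : ℝ} (h : ∀ x, ‖x‖ ≤ C * ‖T x‖ + ‖K x‖) :
    IsClosed (LinearMap.range (T : E →ₗ[ℂ] F) : Set F) := by
  have := finiteDimensional_ker_of_estimate T K hK h
  obtain ⟨Z, hZ, hc⟩ := (Submodule.ClosedComplemented.of_finiteDimensional
    (LinearMap.ker (T : E →ₗ[ℂ] F))).exists_isClosed_isCompl
  have : CompleteSpace Z := hZ.completeSpace_coe
  obtain ⟨C', hC'⟩ := exists_bound_of_injective_of_estimate (T.comp Z.subtypeL)
    (K.comp Z.subtypeL) (hK.comp_clm Z.subtypeL) (C := C) (fun x => h x) fun x hx => by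
      have : (x : E) ∈ LinearMap.ker (T : E →ₗ[ℂ] F) ⊓ Z := ⟨hx, x.2⟩
      rw [hc.inf_eq_bot] at this
      exact Subtype.ext this
  have hcl := (isClosedEmbedding_of_bound _ hC').isClosed_range
  convert hcl using 1
  ext y
  constructor
  · rintro ⟨x, rfl⟩
    have hx : x ∈ LinearMap.ker (T : E →ₗ[ℂ] F) ⊔ Z := by simp [hc.sup_eq_top]
    obtain ⟨n, hn, z, hz, rfl⟩ := Submodule.mem_sup.1 hx
    refine ⟨⟨z, hz⟩, ?_⟩
    have : T n = 0 := hn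
    simp [this]
  · rintro ⟨x, rfl⟩
    exact ⟨x, rfl⟩

end Estimates

/-! ### Upper semi-Fredholm operators and compact perturbations -/

variable {X : Type*} [NormedAddCommGroup X] [NormedSpace ℂ X]

theorem nullity_lt_top {T : X →L[ℂ] X} :
    nullity T < ⊤ ↔ FiniteDimensional ℂ (nullSpace T) := by
  rw [nullity, Cardinal.toENat_lt_top, Module.rank_lt_aleph0_iff, FiniteDimensional]

theorem nullity_pos {T : X →L[ℂ] X} : 0 < nullity T ↔ ∃ x, x ≠ 0 ∧ T x = 0 := by
  rw [pos_iff_ne_zero, nullity, Ne, Cardinal.toENat_eq_zero, rank_zero_iff,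
    Submodule.subsingleton_iff_eq_bot, ← Ne, Submodule.ne_bot_iff]
  exact ⟨fun ⟨x, h1, h2⟩ => ⟨x, h2, h1⟩, fun ⟨x, h1, h2⟩ => ⟨x, h2, h1⟩⟩

theorem phiPlus_of_estimate [CompleteSpace X] {G : Type*} [NormedAddCommGroup G] [NormedSpace ℂ G]
    (T : X →L[ℂ] X) (K : X →L[ℂ] G)
    (hK : IsCompactOperator K) {C : ℝ} (h : ∀ x, ‖x‖ ≤ C * ‖T x‖ + ‖K x‖) : PhiPlus T :=
  ⟨isClosed_range_of_estimate T K hK h,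
    nullity_lt_top.2 (finiteDimensional_ker_of_estimate T K hK h)⟩

theorem isCompactOperator_of_finiteDimensional_range {E F : Type*} [NormedAddCommGroup E]
    [NormedSpace ℂ E] [NormedAddCommGroup F] [NormedSpace ℂ F] (V : Submodule ℂ F)
    [FiniteDimensional ℂ V] (K : E →L[ℂ] V) : IsCompactOperator (V.subtypeL.comp K) := by
  have : ProperSpace V := FiniteDimensional.proper ℂ V
  exact (isCompactOperator_of_locallyCompactSpace_dom K).clm_comp V.subtypeL

/-- An upper semi-Fredholm operator is bounded below modulo a projection onto its kernel. -/
theorem PhiPlus.exists_estimate [CompleteSpace X] {T : X →L[ℂ] X} (hT : PhiPlus T) :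
    ∃ P : X →L[ℂ] X, IsCompactOperator P ∧ (∀ x, T (P x) = 0) ∧ ∃ C : ℝ, 0 < C ∧
      ∀ x, ‖x - P x‖ ≤ C * ‖T x‖ := by
  have := nullity_lt_top.1 hT.2
  obtain ⟨p, hp⟩ := Submodule.ClosedComplemented.of_finiteDimensional (nullSpace T)
  let P := (nullSpace T).subtypeL.comp p
  have hTP : ∀ x, T (P x) = 0 := fun x => (p x).2
  refine ⟨P, isCompactOperator_of_finiteDimensional_range _ p, hTP, ?_⟩
  have hZ : IsClosed (LinearMap.ker (p : X →ₗ[ℂ] nullSpace T) : Set X) := p.isClosed_ker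
  have : CompleteSpace (LinearMap.ker (p : X →ₗ[ℂ] nullSpace T)) := hZ.completeSpace_coe
  let Z := LinearMap.ker (p : X →ₗ[ℂ] nullSpace T)
  have hmem : ∀ x, x - P x ∈ Z := fun x => by
    change p (x - P x) = 0
    rw [map_sub, sub_eq_zero]
    exact (hp (p x)).symm
  let U := T.comp Z.subtypeL
  have hinj : Function.Injective U := by
    refine (injective_iff_map_eq_zero U).2 fun x hx => ?_
    have h1 := hp ⟨x, hx⟩
    have h2 : p x = 0 := x.2
    simp only [h2] at h1
    exact Subtype.ext (congrArg Subtype.val h1).symm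
  have hr : IsClosed (Set.range U) := by
    have hrange : Set.range U = (rangeSpace T : Set X) := by
      ext y
      constructor
      · rintro ⟨x, rfl⟩
        exact ⟨x, rfl⟩
      · rintro ⟨x, rfl⟩
        refine ⟨⟨x - P x, hmem x⟩, ?_⟩
        change T (x - P x) = T x
        rw [map_sub, hTP, sub_zero]
    rw [hrange]
    exact hT.1
  obtain ⟨c, hanti⟩ := U.antilipschitz_of_injective_of_isClosed_range hinj hr
  refine ⟨c + 1, by positivity, fun x => ?_⟩
  have := hanti.le_mul_dist ⟨x - P x, hmem x⟩ 0
  simp only [dist_zero_right, map_zero] at this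
  change ‖x - P x‖ ≤ c * ‖T (x - P x)‖ at this
  rw [map_sub, hTP, sub_zero] at this
  linarith [norm_nonneg (T x)]

theorem PhiPlus.exists_compact_estimate [CompleteSpace X] {T : X →L[ℂ] X} (hT : PhiPlus T) :
    ∃ P : X →L[ℂ] X, IsCompactOperator P ∧ ∃ C : ℝ, ∀ x, ‖x‖ ≤ C * ‖T x‖ + ‖P x‖ := by
  obtain ⟨P, hP, -, C, -, h⟩ := hT.exists_estimate
  refine ⟨P, hP, C, fun x => ?_⟩
  linarith [norm_le_norm_sub_add x (P x), h x]

theorem _root_.IsCompactOperator.prodMk {E F G : Type*} [Zero E] [TopologicalSpace E]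
    [TopologicalSpace F] [TopologicalSpace G] {f : E → F} {g : E → G}
    (hf : IsCompactOperator f) (hg : IsCompactOperator g) :
    IsCompactOperator fun x => (f x, g x) := by
  obtain ⟨A, hA, hfA⟩ := hf
  obtain ⟨B, hB, hgB⟩ := hg
  exact ⟨A ×ˢ B, hA.prod hB, Filter.inter_mem hfA hgB⟩

theorem PhiPlus.add_compact [CompleteSpace X] {T : X →L[ℂ] X} (hT : PhiPlus T) {K : X →L[ℂ] X}
    (hK : IsCompactOperator K) : PhiPlus (T + K) := by
  obtain ⟨P, hP, C, h⟩ := hT.exists_compact_estimate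
  -- The product carries the max norm, so the factors 2 absorb the sum `|C| ‖K x‖ + ‖P x‖`.
  have hK' : IsCompactOperator (((2 * |C| : ℝ) : ℂ) • K) := hK.smul _
  have hP' : IsCompactOperator ((2 : ℂ) • P) := hP.smul _
  refine phiPlus_of_estimate (T + K) ((((2 * |C| : ℝ) : ℂ) • K).prod ((2 : ℂ) • P))
    (hK'.prodMk hP') (C := |C|) fun x => ?_
  have h1 : ‖(((2 * |C| : ℝ) : ℂ) • K) x‖ ≤
    ‖((((2 * |C| : ℝ) : ℂ) • K).prod ((2 : ℂ) • P)) x‖ := le_max_left _ _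
  have h2 : ‖((2 : ℂ) • P) x‖ ≤
    ‖((((2 * |C| : ℝ) : ℂ) • K).prod ((2 : ℂ) • P)) x‖ := le_max_right _ _
  have h3 : ‖(((2 * |C| : ℝ) : ℂ) • K) x‖ = 2 * |C| * ‖K x‖ := by
    rw [_root_.smul_apply, norm_smul, Complex.norm_real, Real.norm_eq_abs,
      abs_of_nonneg (by positivity)]
  have h4 : ‖((2 : ℂ) • P) x‖ = 2 * ‖P x‖ := by
    rw [_root_.smul_apply, norm_smul, Complex.norm_ofNat]
  have h5 : ‖T x‖ ≤ ‖(T + K) x‖ + ‖K x‖ := by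
    simpa using norm_sub_le ((T + K) x) (K x)
  have h6 : C * ‖T x‖ ≤ |C| * (‖(T + K) x‖ + ‖K x‖) :=
    mul_le_mul (le_abs_self C) h5 (norm_nonneg _) (abs_nonneg _)
  linarith [h x]

theorem PhiPlus.isClosed_map [CompleteSpace X] {T : X →L[ℂ] X} (hT : PhiPlus T)
    {M : Submodule ℂ X} (hM : IsClosed (M : Set X)) :
    IsClosed (M.map (T : X →ₗ[ℂ] X) : Set X) := by
  obtain ⟨P, hP, C, h⟩ := hT.exists_compact_estimate
  have : CompleteSpace M := hM.completeSpace_coe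
  have := isClosed_range_of_estimate (T.comp M.subtypeL) (P.comp M.subtypeL)
    (hP.comp_clm M.subtypeL) (C := C) (fun x => h x)
  convert this using 1
  ext y
  simp

/-! ### Powers, the hyperrange and the single valued extension property -/

theorem mem_nullSpace {T : X →L[ℂ] X} {x : X} : x ∈ nullSpace T ↔ T x = 0 := Iff.rfl

theorem pow_succ_apply (T : X →L[ℂ] X) (k : ℕ) (x : X) : (T ^ (k + 1)) x = T ((T ^ k) x) := by
  rw [pow_succ', mul_apply_eq_comp]

theorem pow_succ_apply' (T : X →L[ℂ] X) (k : ℕ) (x : X) : (T ^ (k + 1)) x = (T ^ k) (T x) := by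
  rw [pow_succ, mul_apply_eq_comp]

theorem rangeSpace_pow_succ_le (T : X →L[ℂ] X) (k : ℕ) :
    rangeSpace (T ^ (k + 1)) ≤ rangeSpace (T ^ k) := by
  rintro _ ⟨x, rfl⟩
  exact ⟨T x, (pow_succ_apply' T k x).symm⟩

theorem rangeSpace_pow_antitone (T : X →L[ℂ] X) : Antitone fun k => rangeSpace (T ^ k) :=
  antitone_nat_of_succ_le (rangeSpace_pow_succ_le T)

theorem PhiPlus.isClosed_rangeSpace_pow [CompleteSpace X] {T : X →L[ℂ] X} (hT : PhiPlus T)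
    (k : ℕ) : IsClosed (rangeSpace (T ^ k) : Set X) := by
  induction k with
  | zero =>
    convert isClosed_univ
    ext x
    simp only [Set.mem_univ, iff_true]
    exact ⟨x, by simp⟩
  | succ k ih =>
    convert hT.isClosed_map ih using 1
    ext x
    constructor
    · rintro ⟨y, rfl⟩
      exact ⟨(T ^ k) y, ⟨y, rfl⟩, (pow_succ_apply T k y).symm⟩
    · rintro ⟨_, ⟨y, rfl⟩, rfl⟩
      exact ⟨y, pow_succ_apply T k y⟩

theorem finiteDimensional_nullSpace_pow {T : X →L[ℂ] X} [FiniteDimensional ℂ (nullSpace T)]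
    (k : ℕ) : FiniteDimensional ℂ (nullSpace (T ^ k)) := by
  induction k with
  | zero =>
    have : nullSpace (T ^ 0) = ⊥ := by
      rw [eq_bot_iff]
      intro x hx
      simpa [mem_nullSpace] using hx
    rw [this]
    infer_instance
  | succ k ih =>
    rw [← Submodule.fg_iff_finiteDimensional] at ih ⊢
    refine Submodule.fg_of_fg_map_of_fg_inf_ker (T : X →ₗ[ℂ] X) ?_ ?_
    · have := (Submodule.fg_iff_finiteDimensional _).1 ih
      rw [Submodule.fg_iff_finiteDimensional]
      refine Submodule.finiteDimensional_of_le (S₂ := nullSpace (T ^ k)) ?_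
      rintro _ ⟨x, hx, rfl⟩
      exact (pow_succ_apply' T k x).symm.trans hx
    · rw [Submodule.fg_iff_finiteDimensional]
      exact Submodule.finiteDimensional_of_le (S₂ := nullSpace T) inf_le_right

theorem exists_nullSpace_inf_rangeSpace_pow_stable (T : X →L[ℂ] X)
    [FiniteDimensional ℂ (nullSpace T)] :
    ∃ p, ∀ m, p ≤ m → ∀ x, T x = 0 → x ∈ rangeSpace (T ^ p) → x ∈ rangeSpace (T ^ m) := by
  let f : ℕ →o (Submodule ℂ (nullSpace T))ᵒᵈ :=
    ⟨fun k => OrderDual.toDual ((rangeSpace (T ^ k)).comap (nullSpace T).subtype),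
      fun a b hab => OrderDual.toDual_le_toDual.2
        (Submodule.comap_mono (rangeSpace_pow_antitone T hab))⟩
  obtain ⟨p, hp⟩ := IsArtinian.monotone_stabilizes f
  refine ⟨p, fun m hm x hx hxp => ?_⟩
  have h := congrArg OrderDual.ofDual (hp m hm)
  have h1 : (⟨x, hx⟩ : nullSpace T) ∈ (rangeSpace (T ^ p)).comap (nullSpace T).subtype := hxp
  have h' : (rangeSpace (T ^ p)).comap (nullSpace T).subtype =
    (rangeSpace (T ^ m)).comap (nullSpace T).subtype := h
  rw [h'] at h1
  exact h1

/-- The hyperrange `⋂ R(T ^ k)`. -/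
def hyperRange (T : X →L[ℂ] X) : Submodule ℂ X := ⨅ k, rangeSpace (T ^ k)

theorem mem_hyperRange {T : X →L[ℂ] X} {x : X} :
    x ∈ hyperRange T ↔ ∀ k, x ∈ rangeSpace (T ^ k) := Submodule.mem_iInf _

theorem map_mem_hyperRange (T : X →L[ℂ] X) {x : X} (hx : x ∈ hyperRange T) :
    T x ∈ hyperRange T := by
  rw [mem_hyperRange] at hx ⊢
  intro k
  obtain ⟨y, rfl⟩ := hx k
  exact ⟨T y, ((pow_succ_apply' T k y).symm.trans (pow_succ_apply T k y))⟩

/-- Two preimages of `x`, one in `R(T ^ p)` and one in a deeper range, differ by a kernel vector in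
`R(T ^ p)`; by stability that vector lies in every deeper range. -/
theorem exists_preimage_mem_hyperRange (T : X →L[ℂ] X) [FiniteDimensional ℂ (nullSpace T)]
    {x : X} (hx : x ∈ hyperRange T) : ∃ u ∈ hyperRange T, T u = x := by
  obtain ⟨p, hp⟩ := exists_nullSpace_inf_rangeSpace_pow_stable T
  rw [mem_hyperRange] at hx
  obtain ⟨w, hw⟩ := hx (p + 1)
  have hw : (T ^ (p + 1)) w = x := hw
  rw [pow_succ_apply] at hw
  refine ⟨(T ^ p) w, mem_hyperRange.2 fun k => ?_, hw⟩
  obtain ⟨v, hv⟩ := hx (max p k + 1)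
  have hv : (T ^ (max p k + 1)) v = x := hv
  rw [pow_succ_apply] at hv
  have h1 : (T ^ p) w - (T ^ (max p k)) v ∈ rangeSpace (T ^ (max p k)) := by
    refine hp _ (le_max_left _ _) _ (by rw [map_sub, hw, hv, sub_self]) ?_
    exact sub_mem ⟨w, rfl⟩ (rangeSpace_pow_antitone T (le_max_left p k) ⟨v, rfl⟩)
  have h2 : (T ^ (max p k)) v ∈ rangeSpace (T ^ (max p k)) := ⟨v, rfl⟩
  have h3 := add_mem h1 h2
  rw [sub_add_cancel] at h3
  exact rangeSpace_pow_antitone T (le_max_right p k) h3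

/-- A kernel vector in the hyperrange of an upper semi-Fredholm operator extends to a local
analytic eigenvector function. -/
theorem PhiPlus.exists_analytic_eigenvector [CompleteSpace X] {T : X →L[ℂ] X} (hT : PhiPlus T)
    {x : X} (hx : T x = 0) (hxr : x ∈ hyperRange T) :
    ∃ r > 0, ∃ f : ℂ → X, AnalyticOnNhd ℂ f (Metric.ball 0 r) ∧
      (∀ z ∈ Metric.ball (0 : ℂ) r, T (f z) = z • f z) ∧ f 0 = x := by
  have := nullity_lt_top.1 hT.2
  let M := hyperRange T
  have hM : IsClosed (M : Set X) := by
    have : (M : Set X) = ⋂ k, (rangeSpace (T ^ k) : Set X) := Submodule.coe_iInf _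
    rw [this]
    exact isClosed_iInter hT.isClosed_rangeSpace_pow
  have : CompleteSpace M := hM.completeSpace_coe
  let U : M →L[ℂ] M := (T.comp M.subtypeL).codRestrict M fun y => map_mem_hyperRange T y.2
  have hU : Function.Surjective U := fun y => by
    obtain ⟨u, hu, h⟩ := exists_preimage_mem_hyperRange T y.2
    exact ⟨⟨u, hu⟩, Subtype.ext h⟩
  -- The open mapping theorem gives a backward orbit `T a (n + 1) = a n` growing at most like `C ^
  -- n`; its power series is the eigenvector function.
  obtain ⟨C, hC, hpre⟩ := U.exists_preimage_norm_le hU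
  choose g hg hgn using hpre
  let a : ℕ → X := fun n => (g^[n] ⟨x, hxr⟩ : M)
  have ha0 : a 0 = x := rfl
  have haT : ∀ n, T (a (n + 1)) = a n := fun n => by
    have := congrArg Subtype.val (hg (g^[n] ⟨x, hxr⟩))
    simp only [a, Function.iterate_succ_apply']
    exact this
  have han : ∀ n, ‖a n‖ ≤ C ^ n * ‖x‖ := fun n => by
    induction n with
    | zero => simp [ha0]
    | succ n ih =>
      have h1 := hgn (g^[n] ⟨x, hxr⟩)
      rw [← Function.iterate_succ_apply' g] at h1
      calc ‖a (n + 1)‖ ≤ C * ‖a n‖ := h1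
        _ ≤ C * (C ^ n * ‖x‖) := by gcongr
        _ = _ := by ring
  have hsum : Summable fun n : ℕ => (1 / 2 : ℝ) ^ n * ‖x‖ :=
    (summable_geometric_of_lt_one (by norm_num) (by norm_num)).mul_right _
  have hbound : ∀ (n : ℕ) (z : ℂ), z ∈ Metric.ball (0 : ℂ) (1 / (2 * C)) →
      ‖z ^ n • a n‖ ≤ (1 / 2 : ℝ) ^ n * ‖x‖ := fun n z hz => by
    rw [mem_ball_zero_iff] at hz
    rw [norm_smul, norm_pow]
    calc ‖z‖ ^ n * ‖a n‖ ≤ (1 / (2 * C)) ^ n * (C ^ n * ‖x‖) := by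
          gcongr
          exact han n
      _ = _ := by
        rw [← mul_assoc, ← mul_pow]
        congr 2
        field_simp
  refine ⟨1 / (2 * C), by positivity, fun z => ∑' n, z ^ n • a n, ?_, fun z hz => ?_, ?_⟩
  · refine DifferentiableOn.analyticOnNhd ?_ Metric.isOpen_ball
    refine Complex.differentiableOn_tsum_of_summable_norm hsum (fun n => ?_) Metric.isOpen_ball hbound
    exact ((differentiable_id.pow n).smul_const (a n)).differentiableOn
  · have hs : Summable fun n => z ^ n • a n := hsum.of_norm_bounded fun n => hbound n z hz
    rw [T.map_tsum hs, (hs.mapL T).tsum_eq_zero_add, ← tsum_const_smul'' z]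
    have h0 : T (z ^ 0 • a 0) = 0 := by simp [ha0, hx]
    rw [h0, zero_add]
    refine tsum_congr fun n => ?_
    rw [map_smul, haT, smul_smul, pow_succ']
  · beta_reduce
    rw [tsum_eq_single 0 fun n hn => by simp [hn]]
    simp [ha0]

theorem PhiPlus.exists_nullSpace_inf_rangeSpace_pow_eq_zero [CompleteSpace X] {S : X →L[ℂ] X}
    (hS : SVEP S) {z : ℂ} (hz : PhiPlus (shift S z)) :
    ∃ p, ∀ x, shift S z x = 0 → x ∈ rangeSpace (shift S z ^ p) → x = 0 := by
  have := nullity_lt_top.1 hz.2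
  obtain ⟨p, hp⟩ := exists_nullSpace_inf_rangeSpace_pow_stable (shift S z)
  refine ⟨p, fun x hx hxp => ?_⟩
  have hxr : x ∈ hyperRange (shift S z) := mem_hyperRange.2 fun k =>
    rangeSpace_pow_antitone _ (le_max_right p k) (hp _ (le_max_left p k) x hx hxp)
  obtain ⟨r, hr, f, hf, hfe, hf0⟩ := hz.exists_analytic_eigenvector hx hxr
  have hmaps : ∀ w ∈ Metric.ball z r, w - z ∈ Metric.ball (0 : ℂ) r := fun w hw => by
    rwa [mem_ball_zero_iff, ← mem_ball_iff_norm]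
  have := hS (Metric.ball z r) Metric.isOpen_ball (fun w => f (w - z)) ?_ ?_ z
    (Metric.mem_ball_self hr)
  · simpa [hf0] using this
  · exact hf.comp ((analyticOnNhd_id).sub analyticOnNhd_const) hmaps
  · intro w hw
    have h := hfe (w - z) (hmaps w hw)
    simp only [shift, _root_.sub_apply, _root_.smul_apply,
      ContinuousLinearMap.id_apply, sub_smul] at h ⊢
    rw [sub_eq_iff_eq_add] at h
    rw [h]
    abel

theorem SVEP.of_quasiaffineTransform {S T : X →L[ℂ] X} (hT : SVEP T)
    (h : QuasiaffineTransform S T) : SVEP S := by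
  obtain ⟨A, ⟨hA, -⟩, hAS⟩ := h
  intro U hU f hf hfz z hz
  have hker : ∀ x, A x = 0 → x = 0 := fun x hx => by
    have : x ∈ nullSpace A := hx
    rwa [hA, Submodule.mem_bot] at this
  refine hker _ (hT U hU (fun w => A (f w)) (A.comp_analyticOnNhd hf) (fun w hw => ?_) z hz)
  have h1 := congrArg A (hfz w hw)
  have h2 := congrArg (fun B : X →L[ℂ] X => B (f w)) hAS
  simp only [shift, _root_.sub_apply, _root_.smul_apply, ContinuousLinearMap.id_apply,
    ContinuousLinearMap.comp_apply, map_sub, map_smul, map_zero] at h1 h2 ⊢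
  rw [← h2, h1]

/-! ### A commuting compact operator that is the identity on the kernel -/

/-- A linear map on a finite dimensional subspace `V` that vanishes on `V ∩ R`, with `R` closed,
extends to a finite rank operator that vanishes on `R` and has the same range. -/
theorem exists_compact_extension_vanishing (V R : Submodule ℂ X) [FiniteDimensional ℂ V]
    (hR : IsClosed (R : Set X)) (L : V →ₗ[ℂ] X) (hL : ∀ v : V, (v : X) ∈ R → L v = 0) :
    ∃ Q : X →L[ℂ] X, IsCompactOperator Q ∧ (∀ x ∈ R, Q x = 0) ∧ (∀ v : V, Q v = L v) ∧
      ∀ x, ∃ v, Q x = L v := by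
  have : IsClosed (R : Set X) := hR
  let j : V →ₗ[ℂ] X ⧸ R := R.mkQ.comp V.subtype
  obtain ⟨r, hr⟩ := j.rangeRestrict.exists_rightInverse_of_surjective j.range_rangeRestrict
  obtain ⟨q, hq⟩ := Submodule.ClosedComplemented.of_finiteDimensional (LinearMap.range j)
  let h : LinearMap.range j →L[ℂ] X := LinearMap.toContinuousLinearMap (L.comp r)
  have : ProperSpace (LinearMap.range j) := FiniteDimensional.proper ℂ _
  have hcomp : IsCompactOperator h := isCompactOperator_of_locallyCompactSpace_rng h
  refine ⟨h.comp (q.comp R.mkQL), hcomp.comp_clm _, fun x hx => ?_, fun v => ?_, fun x => ?_⟩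
  · have : R.mkQL x = 0 := (Submodule.Quotient.mk_eq_zero R).2 hx
    simp [this]
  · have h1 : q (R.mkQL v) = j.rangeRestrict v := hq (j.rangeRestrict v)
    have h2 : j.rangeRestrict (r (j.rangeRestrict v)) = j.rangeRestrict v :=
      LinearMap.congr_fun hr _
    have h3 : ((r (j.rangeRestrict v) - v : V) : X) ∈ R := by
      refine (Submodule.Quotient.mk_eq_zero R).1 ?_
      have := congrArg Subtype.val h2
      change j _ = j v at this
      rw [← sub_eq_zero, ← map_sub] at this
      exact this
    have h4 := hL _ h3
    rw [map_sub, sub_eq_zero] at h4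
    change L (r (q (R.mkQL v))) = L v
    rw [h1, h4]
  · exact ⟨r (q (R.mkQL x)), rfl⟩

/-- The commutator telescopes to `T ^ (k + 1) * Q - Q * T ^ (k + 1)`. -/
theorem commute_sum_pow_mul_pow {A : Type*} [Ring A] (T Q : A) (k : ℕ)
    (h1 : T ^ (k + 1) * Q = 0) (h2 : Q * T ^ (k + 1) = 0) :
    Commute T (∑ j ∈ Finset.range (k + 1), T ^ j * Q * T ^ (k - j)) := by
  rw [Commute, SemiconjBy, ← sub_eq_zero, Finset.mul_sum, Finset.sum_mul,
    ← Finset.sum_sub_distrib]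
  have := Finset.sum_range_sub (fun j => T ^ j * Q * T ^ (k + 1 - j)) (k + 1)
  simp only [Nat.sub_self, pow_zero, mul_one, h1, one_mul, Nat.sub_zero, h2, sub_zero] at this
  rw [← this]
  refine Finset.sum_congr rfl fun j hj => ?_
  have hj : j ≤ k := Nat.lt_succ_iff.1 (Finset.mem_range.1 hj)
  rw [Nat.add_sub_add_right, Nat.sub_add_comm hj, pow_succ' T j, pow_succ T (k - j)]
  simp only [mul_assoc]

/-- Descending induction on `k` from `p`, where the intersection is zero. Given `K` for `k + 1`, the
error `v - K v` on `N(T) ∩ R(T ^ k)` vanishes on `R(T ^ (k + 1))`. Lift it through `T ^ k` to an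
operator `Q`, then symmetrise `Q` into a correction commuting with `T`. -/
theorem PhiPlus.exists_commuting_compact_eq_id_on_kernel [CompleteSpace X] {T : X →L[ℂ] X}
    (hT : PhiPlus T) {p : ℕ} (hp : ∀ x, T x = 0 → x ∈ rangeSpace (T ^ p) → x = 0) (i : ℕ) :
    ∀ k, k + i = p → ∃ K : X →L[ℂ] X, IsCompactOperator K ∧ Commute T K ∧ T ^ p * K = 0 ∧
      ∀ x, T x = 0 → x ∈ rangeSpace (T ^ k) → K x = x := by
  have := nullity_lt_top.1 hT.2
  induction i with
  | zero =>
    rintro k rfl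
    exact ⟨0, isCompactOperator_zero, Commute.zero_right T, mul_zero _, fun x h1 h2 => by
      simp [hp x h1 h2]⟩
  | succ i ih =>
    intro k hk
    obtain ⟨K, hKc, hTK, hpK, hK⟩ := ih (k + 1) (by omega)
    let V := nullSpace T ⊓ rangeSpace (T ^ k)
    have hV : FiniteDimensional ℂ V := Submodule.finiteDimensional_of_le (S₂ := nullSpace T)
      inf_le_left
    obtain ⟨s, hs'⟩ : ∃ s : rangeSpace (T ^ k) →ₗ[ℂ] X, ∀ y, (T ^ k) (s y) = y := by
      obtain ⟨s, hs⟩ := LinearMap.exists_rightInverse_of_surjective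
        ((T ^ k : X →L[ℂ] X) : X →ₗ[ℂ] X).rangeRestrict (LinearMap.range_rangeRestrict _)
      exact ⟨s, fun y => congrArg Subtype.val (LinearMap.congr_fun hs y)⟩
    have hmem : ∀ v : V, (v : X) - K v ∈ rangeSpace (T ^ k) := fun v => by
      obtain ⟨u, hu⟩ := v.2.2
      have hu : (T ^ k) u = v := hu
      refine sub_mem v.2.2 ⟨K u, ?_⟩
      rw [← hu]
      exact congrArg (fun B : X →L[ℂ] X => B u) (hTK.pow_left k).eq
    let L₀ : V →ₗ[ℂ] rangeSpace (T ^ k) :=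
      (V.subtype - (K : X →ₗ[ℂ] X).comp V.subtype).codRestrict _ hmem
    have hL₀ : ∀ v, (L₀ v : X) = v - K v := fun v => rfl
    obtain ⟨Q, hQc, hQR, hQV, hQ⟩ := exists_compact_extension_vanishing V
      (rangeSpace (T ^ (k + 1))) (hT.isClosed_rangeSpace_pow (k + 1)) (s.comp L₀) fun v hv => by
        have : L₀ v = 0 := Subtype.ext (by rw [hL₀, hK v v.2.1 hv, sub_self]; rfl)
        simp [this]
    have h1 : T ^ (k + 1) * Q = 0 := by
      ext x
      obtain ⟨v, hv⟩ := hQ x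
      have hTv : T v = 0 := v.2.1
      have hTK' : T (K v) = K (T v) := congrArg (fun B : X →L[ℂ] X => B v) hTK.eq
      rw [mul_apply_eq_comp, hv, LinearMap.comp_apply, pow_succ_apply, hs', hL₀, map_sub, hTK',
        hTv, map_zero, sub_zero]
      rfl
    have h2 : Q * T ^ (k + 1) = 0 := by
      ext x
      exact hQR _ ⟨x, rfl⟩
    let M := ∑ j ∈ Finset.range (k + 1), T ^ j * Q * T ^ (k - j)
    have hMc : IsCompactOperator M := by
      have : M ∈ compactOperator (RingHom.id ℂ) X X := Submodule.sum_mem _ fun j _ =>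
        (hQc.clm_comp (T ^ j)).comp_clm (T ^ (k - j))
      exact this
    refine ⟨K + M, hKc.add hMc, hTK.add_right (commute_sum_pow_mul_pow T Q k h1 h2), ?_, ?_⟩
    · rw [mul_add, hpK, zero_add, Finset.mul_sum]
      refine Finset.sum_eq_zero fun j _ => ?_
      have : T ^ p * T ^ j = T ^ (i + j) * T ^ (k + 1) := by
        rw [← pow_add, ← pow_add]
        congr 1
        omega
      rw [← mul_assoc, ← mul_assoc, this, mul_assoc (T ^ (i + j)), h1, mul_zero, zero_mul]
    · intro x hx hxk
      have hM : M x = x - K x := by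
        have h3 : Q x = s (L₀ ⟨x, hx, hxk⟩) := hQV ⟨x, hx, hxk⟩
        have h4 : (T ^ k) (Q x) = x - K x := by rw [h3, hs', hL₀]
        simp only [M, _root_.sum_apply, mul_apply_eq_comp]
        -- On the kernel only the term `j = k` survives, the others ending in a positive power of
        -- `T`.
        rw [Finset.sum_range_succ, Finset.sum_eq_zero, zero_add, Nat.sub_self, pow_zero]
        · exact h4
        · intro j hj
          have hj : j < k := Finset.mem_range.1 hj
          obtain ⟨m, hm⟩ : ∃ m, k - j = m + 1 := ⟨k - j - 1, by omega⟩
          rw [hm, pow_succ_apply', hx, map_zero, map_zero, map_zero]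
      rw [_root_.add_apply, hM, add_sub_cancel]

/-- From `T x = -K x` and `T ^ p * K = 0`, `x` is killed by a power of `T`. Descending through the
powers reduces to `T x = 0`, where `(T + K) x = x`. -/
theorem eq_zero_of_add_apply_eq_zero {T K : X →L[ℂ] X} (hTK : Commute T K) {p : ℕ}
    (hp : T ^ p * K = 0) (hK : ∀ x, T x = 0 → K x = x) {x : X} (hx : (T + K) x = 0) : x = 0 := by
  have key : ∀ n, ∀ x, (T ^ n) x = 0 → (T + K) x = 0 → x = 0 := by
    intro n
    induction n with
    | zero => intro x h _; simpa using h
    | succ n ih =>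
      intro x h1 h2
      have hcomm : (T + K) (T x) = T ((T + K) x) :=
        congrArg (fun B : X →L[ℂ] X => B x) ((Commute.refl T).add_right hTK).eq.symm
      have hTx : T x = 0 := ih _ (by rwa [← pow_succ_apply']) (by rw [hcomm, h2, map_zero])
      rwa [_root_.add_apply, hTx, hK x hTx, zero_add] at h2
  refine key (p + 1) x ?_ hx
  rw [_root_.add_apply, add_eq_zero_iff_eq_neg] at hx
  have h0 : (T ^ p) (K x) = 0 := congrArg (fun B : X →L[ℂ] X => B x) hp
  rw [pow_succ_apply', hx, map_neg, h0, neg_zero]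

theorem PhiPlus.exists_bound_of_injective [CompleteSpace X] {T : X →L[ℂ] X} (hT : PhiPlus T)
    (hinj : ∀ x, T x = 0 → x = 0) : ∃ C : ℝ, 0 < C ∧ ∀ x, ‖x‖ ≤ C * ‖T x‖ := by
  obtain ⟨P, -, hP, C, hC, h⟩ := hT.exists_estimate
  refine ⟨C, hC, fun x => ?_⟩
  have := h x
  rwa [hinj _ (hP x), sub_zero] at this

theorem shift_apply (T : X →L[ℂ] X) (z : ℂ) (x : X) : shift T z x = T x - z • x := rfl

theorem not_mem_sigmaA_iff {S : X →L[ℂ] X} {z : ℂ} :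
    z ∉ sigmaA S ↔ HasClosedRange (shift S z) ∧ ∀ x, shift S z x = 0 → x = 0 := by
  simp only [sigmaA, Set.mem_ofPred_eq, nullity_pos]
  push Not
  exact and_congr_right fun _ => ⟨fun h x hx => by_contra fun h0 => h x h0 hx,
    fun h x h0 hx => h0 (h x hx)⟩

theorem phiPlus_of_not_mem_sigmaA {S : X →L[ℂ] X} {z : ℂ} (h : z ∉ sigmaA S) :
    PhiPlus (shift S z) := by
  simp only [sigmaA, Set.mem_ofPred_eq, not_or, not_not, not_lt, nonpos_iff_eq_zero] at h
  exact ⟨h.1, by rw [h.2]; exact ENat.natCast_lt_top 0⟩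

/-- Near `z`, `S - w` is bounded below when `S - z` becomes injective after adding a commuting
compact operator `K` that `S - z` maps to zero eventually. -/
theorem PhiPlus.eventually_not_mem_sigmaA [CompleteSpace X] {S K : X →L[ℂ] X} {z : ℂ}
    (hz : PhiPlus (shift S z)) (hKc : IsCompactOperator K) (hK : Commute (shift S z) K) {p : ℕ}
    (hp : shift S z ^ p * K = 0) (hinj : ∀ x, (shift S z + K) x = 0 → x = 0) :
    ∀ᶠ w in 𝓝[≠] z, w ∉ sigmaA S := by
  obtain ⟨C, hC, hb⟩ := (hz.add_compact hKc).exists_bound_of_injective hinj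
  -- With this radius, passing from `z` to `w` costs at most half of `‖x‖` in the lower bound.
  have hnear : ∀ᶠ w in 𝓝[≠] z, w ∈ Metric.ball z (1 / (2 * C)) :=
    eventually_nhdsWithin_of_eventually_nhds (Metric.ball_mem_nhds z (by positivity))
  filter_upwards [hnear, self_mem_nhdsWithin] with w hw hwz
  have hwz : w - z ≠ 0 := sub_ne_zero.2 hwz
  rw [mem_ball_iff_norm, lt_div_iff₀ (by positivity)] at hw
  have hexp : ∀ x, shift S w x = shift S z x - (w - z) • x := fun x => by
    simp only [shift_apply, sub_smul]
    abel
  have hbw : ∀ x, ‖x‖ ≤ 2 * C * ‖(shift S w + K) x‖ := fun x => by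
    have h1 : (shift S z + K) x = (shift S w + K) x + (w - z) • x := by
      simp only [_root_.add_apply, hexp]
      abel
    have h2 : ‖(shift S z + K) x‖ ≤ ‖(shift S w + K) x‖ + ‖w - z‖ * ‖x‖ := by
      rw [h1, ← norm_smul]
      exact norm_add_le _ _
    have h3 := (hb x).trans (mul_le_mul_of_nonneg_left h2 hC.le)
    nlinarith [norm_nonneg x]
  have hphi : PhiPlus (shift S w + K) := phiPlus_of_estimate _ (0 : X →L[ℂ] X)
    isCompactOperator_zero (C := 2 * C) fun x => by simpa using hbw x
  have hphi' : PhiPlus (shift S w) := by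
    have := hphi.add_compact (K := -K) hKc.neg
    rwa [add_neg_cancel_right] at this
  refine not_mem_sigmaA_iff.2 ⟨hphi'.1, fun x hx => ?_⟩
  have hTx : shift S z x = (w - z) • x := by
    rw [← sub_eq_zero, ← hexp, hx]
  have hpow : ∀ n, (shift S z ^ n) x = (w - z) ^ n • x := fun n => by
    induction n with
    | zero => simp
    | succ n ih => rw [pow_succ_apply, ih, map_smul, hTx, smul_smul, pow_succ]
  -- On an eigenvector, `S - z` acts as the nonzero scalar `w - z`, while its `p`-th power kills `K
  -- x`.
  have hKx : K x = 0 := by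
    have h1 : (shift S z ^ p) (K x) = K ((shift S z ^ p) x) :=
      congrArg (fun B : X →L[ℂ] X => B x) (hK.pow_left p).eq
    have h2 : (shift S z ^ p) (K x) = 0 := congrArg (fun B : X →L[ℂ] X => B x) hp
    rw [h2, hpow, map_smul, eq_comm, smul_eq_zero] at h1
    exact h1.resolve_left (pow_ne_zero _ hwz)
  have := hbw x
  rw [_root_.add_apply, hx, hKx, add_zero, norm_zero, mul_zero] at this
  exact norm_le_zero_iff.1 this

/-! ### Sign of the index -/

/-- On the finite dimensional space `E = N(T ^ p)` nullity and defect agree. Finite ascent gives `x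
∈ E` whenever `T x ∈ E`, so `E / T E` embeds in `X / R(T)`. -/
theorem nullity_le_defect {T : X →L[ℂ] X} [FiniteDimensional ℂ (nullSpace T)] {p : ℕ}
    (hp : ∀ x, T x = 0 → x ∈ rangeSpace (T ^ p) → x = 0) : nullity T ≤ defect T := by
  have hE := finiteDimensional_nullSpace_pow (T := T) p
  let E := nullSpace (T ^ p)
  have hasc : ∀ x, (T ^ p) (T x) = 0 → (T ^ p) x = 0 := fun x hx => by
    refine hp _ ?_ ⟨x, rfl⟩
    rwa [← pow_succ_apply, pow_succ_apply']
  have hmap : ∀ x ∈ E, T x ∈ E := fun x hx => by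
    change (T ^ p) (T x) = 0
    have hx : (T ^ p) x = 0 := hx
    rw [← pow_succ_apply', pow_succ_apply, hx, map_zero]
  let U : E →ₗ[ℂ] E := (T : X →ₗ[ℂ] X).restrict hmap
  have hN : nullSpace T ≤ E := fun x hx => by
    by_cases h0 : p = 0
    · subst h0
      exact (by simpa using hp x hx ⟨x, by simp⟩ : x = 0) ▸ E.zero_mem
    · obtain ⟨m, rfl⟩ := Nat.exists_eq_succ_of_ne_zero h0
      have hx : T x = 0 := hx
      change (T ^ (m + 1)) x = 0
      rw [pow_succ_apply', hx, map_zero]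
  have h1 : Module.finrank ℂ (nullSpace T) ≤ Module.finrank ℂ (LinearMap.ker U) := by
    let f : nullSpace T →ₗ[ℂ] LinearMap.ker U := (Submodule.inclusion hN).codRestrict _
      fun x => Subtype.ext x.2
    exact LinearMap.finrank_le_finrank_of_injective (f := f) fun x y hxy => by
      have := congrArg (fun u : LinearMap.ker U => ((u : E) : X)) hxy
      exact Subtype.ext this
  have h2 : Module.finrank ℂ (LinearMap.ker U) =
      Module.finrank ℂ (E ⧸ LinearMap.range U) := by
    have := U.finrank_range_add_finrank_ker
    have := (LinearMap.range U).finrank_quotient_add_finrank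
    omega
  have h3 : Module.rank ℂ (E ⧸ LinearMap.range U) ≤ Module.rank ℂ (X ⧸ rangeSpace T) := by
    have hle : LinearMap.range U ≤ (rangeSpace T).comap E.subtype := by
      rintro _ ⟨x, rfl⟩
      exact ⟨x, rfl⟩
    refine LinearMap.rank_le_of_injective
      ((LinearMap.range U).mapQ (rangeSpace T) E.subtype hle) ?_
    refine (injective_iff_map_eq_zero _).2 fun y hy => ?_
    obtain ⟨e, rfl⟩ := Submodule.Quotient.mk_surjective _ y
    rw [Submodule.mapQ_apply, Submodule.Quotient.mk_eq_zero] at hy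
    rw [Submodule.Quotient.mk_eq_zero]
    obtain ⟨x, hx⟩ := hy
    have hx : T x = e := hx
    exact ⟨⟨x, hasc x (by rw [hx]; exact e.2)⟩, Subtype.ext hx⟩
  refine OrderHomClass.mono Cardinal.toENat (le_trans ?_ h3)
  rw [← Module.finrank_eq_rank, ← Module.finrank_eq_rank, ← h2]
  exact_mod_cast h1

theorem index_nonpos {T : X →L[ℂ] X} (h : nullity T ≤ defect T) : index T ≤ 0 := by
  have h' : ((nullity T : ℝ≥0∞) : EReal) ≤ ((defect T : ℝ≥0∞) : EReal) := by
    exact_mod_cast h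
  exact EReal.sub_nonpos.2 h'

/-! ### The reduced minimum modulus -/

theorem PhiPlus.gamma_pos [CompleteSpace X] {S : X →L[ℂ] X} {z : ℂ}
    (hz : PhiPlus (shift S z)) : 0 < gamma S z := by
  obtain ⟨P, -, hP, C, hC, h⟩ := hz.exists_estimate
  refine lt_of_lt_of_le (b := ENNReal.ofReal (1 / C)) (by simpa using hC)
    (le_iInf₂ fun x hx => ENNReal.ofReal_le_ofReal ?_)
  have hcl : IsClosed (nullSpace (shift S z) : Set X) := (shift S z).isClosed_ker
  have hpos : 0 < Metric.infDist x (nullSpace (shift S z) : Set X) :=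
    (hcl.notMem_iff_infDist_pos ⟨0, (nullSpace (shift S z)).zero_mem⟩).1 hx
  have hle : Metric.infDist x (nullSpace (shift S z) : Set X) ≤ ‖x - P x‖ := by
    rw [← dist_eq_norm]
    exact Metric.infDist_le_dist_of_mem (hP x)
  rw [div_le_div_iff₀ hC hpos, one_mul, mul_comm]
  exact hle.trans (h x)

theorem phiPlus_of_gamma_pos [CompleteSpace X] {S : X →L[ℂ] X} {z : ℂ}
    (hfin : nullity (shift S z) < ⊤) (hz : 0 < gamma S z) : PhiPlus (shift S z) := by
  have := nullity_lt_top.1 hfin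
  let N := nullSpace (shift S z)
  have : FiniteDimensional ℂ N := this
  obtain ⟨c, hc0, hc⟩ := ENNReal.lt_iff_exists_nnreal_btwn.1 hz
  have hc0 : 0 < (c : ℝ) := by exact_mod_cast hc0
  have hdist : ∀ x, c * Metric.infDist x (N : Set X) ≤ ‖shift S z x‖ := fun x => by
    by_cases hx : x ∈ N
    · rw [Metric.infDist_zero_of_mem hx, mul_zero]
      exact norm_nonneg _
    · have hcl : IsClosed (N : Set X) := (shift S z).isClosed_ker
      have hpos : 0 < Metric.infDist x (N : Set X) :=
        (hcl.notMem_iff_infDist_pos ⟨0, N.zero_mem⟩).1 hx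
      have h1 : (c : ℝ≥0∞) ≤
          ENNReal.ofReal (‖shift S z x‖ / Metric.infDist x (N : Set X)) :=
        hc.le.trans (iInf₂_le x hx)
      rw [← ENNReal.ofReal_coe_nnreal, ENNReal.ofReal_le_ofReal_iff (by positivity)] at h1
      exact (le_div_iff₀ hpos).1 h1
  obtain ⟨p, hp⟩ := Submodule.ClosedComplemented.of_finiteDimensional N
  let P := N.subtypeL.comp p
  let D : ℝ := ‖ContinuousLinearMap.id ℂ X - P‖ + 1
  have hD : 0 < D := by positivity
  -- `1 - P` kills `N`, so `‖x - P x‖` is at most `‖1 - P‖` times the distance to `N`; the 1 added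
  -- in `D` only ensures `D > 0`.
  have hproj : ∀ x, ‖x - P x‖ / D ≤ Metric.infDist x (N : Set X) := fun x => by
    refine (Metric.le_infDist ⟨0, N.zero_mem⟩).2 fun n hn => ?_
    have hPn : P n = n := congrArg Subtype.val (hp ⟨n, hn⟩)
    have h1 : x - P x = (ContinuousLinearMap.id ℂ X - P) (x - n) := by
      simp [hPn]
    rw [div_le_iff₀ hD, dist_eq_norm, h1, mul_comm]
    refine (ContinuousLinearMap.le_opNorm _ _).trans ?_
    gcongr
    simp [D]
  refine phiPlus_of_estimate _ P (isCompactOperator_of_finiteDimensional_range N p)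
    (C := D / c) fun x => ?_
  have h1 := mul_le_mul_of_nonneg_left (hproj x) hc0.le
  have h2 : ‖x - P x‖ ≤ D / c * ‖shift S z x‖ := by
    have h3 := h1.trans (hdist x)
    rw [div_mul_eq_mul_div, le_div_iff₀ hc0]
    rw [mul_div_assoc', div_le_iff₀ hD] at h3
    linarith
  linarith [norm_le_norm_sub_add x (P x)]

theorem gamma_le_of_not_mem_sigmaA {S : X →L[ℂ] X} {z w : ℂ} (hz : 0 < nullity (shift S z))
    (hw : w ∉ sigmaA S) : gamma S w ≤ ENNReal.ofReal ‖w - z‖ := by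
  obtain ⟨x, hx0, hx⟩ := nullity_pos.1 hz
  have hN : nullSpace (shift S w) = ⊥ :=
    (Submodule.eq_bot_iff _).2 (not_mem_sigmaA_iff.1 hw).2
  refine (iInf₂_le x (by rw [hN]; exact hx0)).trans (ENNReal.ofReal_le_ofReal ?_)
  have h1 : shift S w x = -((w - z) • x) := by
    rw [shift_apply, sub_eq_zero] at hx
    rw [shift_apply, hx, sub_smul]
    abel
  rw [hN, Submodule.bot_coe, Metric.infDist_singleton, dist_zero_right, h1, norm_neg, norm_smul,
    mul_div_cancel_right₀ _ (norm_ne_zero_iff.2 hx0)]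

theorem mem_iso_iff {K : Set ℂ} {z : ℂ} : z ∈ iso K ↔ z ∈ K ∧ ∀ᶠ w in 𝓝[≠] z, w ∉ K := by
  rw [iso, Set.mem_sdiff, mem_derivedSet, accPt_iff_frequently_nhdsNE, not_frequently]

theorem tendsto_gamma_of_mem_piA {S : X →L[ℂ] X} {z : ℂ} (hz : z ∈ piA S) :
    Tendsto (gamma S) (𝓝[≠] z) (𝓝 0) := by
  have hlim : Tendsto (fun w => ENNReal.ofReal ‖w - z‖) (𝓝[≠] z) (𝓝 0) := by
    have : Continuous fun w : ℂ => ENNReal.ofReal ‖w - z‖ :=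
      ENNReal.continuous_ofReal.comp (by fun_prop)
    simpa using (this.tendsto z).mono_left nhdsWithin_le_nhds
  refine tendsto_of_tendsto_of_tendsto_of_le_of_le' tendsto_const_nhds hlim
    (Eventually.of_forall fun _ => zero_le) ?_
  filter_upwards [(mem_iso_iff.1 hz.1).2] with w hw
  exact gamma_le_of_not_mem_sigmaA hz.2.1 hw

theorem hasClosedRange_iff_not_continuousAt_gamma [CompleteSpace X] {S : X →L[ℂ] X} {z : ℂ}
    (hz : z ∈ piA S) : HasClosedRange (shift S z) ↔ ¬ ContinuousAt (gamma S) z := by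
  have hlim := tendsto_gamma_of_mem_piA hz
  have h1 : ContinuousAt (gamma S) z ↔ gamma S z = 0 := by
    rw [continuousAt_iff_punctured_nhds]
    exact ⟨fun h => tendsto_nhds_unique h hlim, fun h => by rwa [h]⟩
  rw [h1, ← Ne, ← pos_iff_ne_zero]
  exact ⟨fun h => PhiPlus.gamma_pos ⟨h, hz.2.2⟩, fun h => (phiPlus_of_gamma_pos hz.2.2 h).1⟩

/-! ### The Browder spectrum and the equivalences -/

theorem shift_add (S K : X →L[ℂ] X) (z : ℂ) : shift (S + K) z = shift S z + K := by
  simp only [shift]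
  abel

theorem commute_shift_iff {S K : X →L[ℂ] X} {z : ℂ} :
    Commute (shift S z) K ↔ Commute S K := by
  have h : Commute (z • ContinuousLinearMap.id ℂ X) K :=
    (Commute.one_left K).smul_left z
  refine ⟨fun hc => ?_, fun hc => hc.sub_left h⟩
  have := hc.add_left h
  rwa [shift, sub_add_cancel] at this

/-- Some `S + K - z` is injective with closed range; subtracting the compact `K` preserves the upper
semi-Fredholm property. -/
theorem phiPlus_of_not_mem_sigmaAB [CompleteSpace X] {S : X →L[ℂ] X} {z : ℂ}
    (hz : z ∉ sigmaAB S) : PhiPlus (shift S z) := by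
  simp only [sigmaAB, Set.mem_ofPred_eq] at hz
  push Not at hz
  obtain ⟨K, hK, -, hz⟩ := hz
  have h := (phiPlus_of_not_mem_sigmaA hz).add_compact (K := -K) hK.neg
  rwa [shift_add, add_neg_cancel_right] at h

theorem PhiPlus.of_mem_sigmaA_of_sVEP [CompleteSpace X] {S : X →L[ℂ] X} (hS : SVEP S) {z : ℂ}
    (hz : PhiPlus (shift S z)) (hza : z ∈ sigmaA S) :
    z ∈ piA S ∧ z ∉ sigmaEA S ∧ z ∉ sigmaAB S := by
  have := nullity_lt_top.1 hz.2
  obtain ⟨p, hp⟩ := hz.exists_nullSpace_inf_rangeSpace_pow_eq_zero hS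
  obtain ⟨K, hKc, hK, hpK, hKid⟩ := hz.exists_commuting_compact_eq_id_on_kernel hp p 0 (zero_add p)
  have hKid : ∀ x, shift S z x = 0 → K x = x := fun x hx => hKid x hx ⟨x, by simp⟩
  have hinj : ∀ x, (shift S z + K) x = 0 → x = 0 := fun x hx =>
    eq_zero_of_add_apply_eq_zero hK hpK hKid hx
  refine ⟨⟨mem_iso_iff.2 ⟨hza, hz.eventually_not_mem_sigmaA hKc hK hpK hinj⟩,
    hza.resolve_left (not_not.2 hz.1), hz.2⟩,
    not_not.2 ⟨hz, index_nonpos (nullity_le_defect hp)⟩, fun h => ?_⟩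
  refine not_mem_sigmaA_iff.2 ?_ (h K hKc (commute_shift_iff.1 hK))
  rw [shift_add]
  exact ⟨(hz.add_compact hKc).1, hinj⟩

theorem aWeyl_tfae_of_sVEP [CompleteSpace X] {S : X →L[ℂ] X} (hS : SVEP S) :
    List.TFAE [AWeyl S,
      ∀ z ∈ piA S, HasClosedRange (shift S z),
      ∀ z ∈ piA S, ¬ ContinuousAt (gamma S) z,
      sigmaEA S ∩ piA S = ∅,
      piA S = sigmaA S \ sigmaAB S] := by
  have hphi : ∀ z, z ∉ sigmaEA S → PhiPlus (shift S z) := fun z hz => (not_not.1 hz).1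
  tfae_have 2 ↔ 3 := forall₂_congr fun z hz => hasClosedRange_iff_not_continuousAt_gamma hz
  tfae_have 1 → 4 := fun h => by
    rw [AWeyl] at h
    rw [← h]
    exact Set.inter_sdiff_self _ _
  tfae_have 4 → 2 := fun h z hz =>
    (hphi z fun hze => Set.notMem_empty z (h ▸ ⟨hze, hz⟩)).1
  tfae_have 2 → 1 := fun h => Set.ext fun z =>
    ⟨fun hz => ((hphi z hz.2).of_mem_sigmaA_of_sVEP hS hz.1).1, fun hz =>
      ⟨hz.1.1, (PhiPlus.of_mem_sigmaA_of_sVEP hS ⟨h z hz, hz.2.2⟩ hz.1.1).2.1⟩⟩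
  tfae_have 2 → 5 := fun h => Set.ext fun z =>
    ⟨fun hz => ⟨hz.1.1, (PhiPlus.of_mem_sigmaA_of_sVEP hS ⟨h z hz, hz.2.2⟩ hz.1.1).2.2⟩,
      fun hz => ((phiPlus_of_not_mem_sigmaAB hz.2).of_mem_sigmaA_of_sVEP hS hz.1).1⟩
  tfae_have 5 → 2 := fun h z hz =>
    (phiPlus_of_not_mem_sigmaAB (h.le hz).2).1
  tfae_finish

end OperatorSpectra
end

theorem corollary3p3 {X : Type*} [NormedAddCommGroup X] [NormedSpace ℂ X] [CompleteSpace X]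
    (hX : ¬ FiniteDimensional ℂ X) (S T : X →L[ℂ] X)
    (hT : OperatorSpectra.SVEP T) (hST : OperatorSpectra.QuasiaffineTransform S T) :
    List.TFAE [
      OperatorSpectra.AWeyl S,
      ∀ z ∈ OperatorSpectra.piA S, OperatorSpectra.HasClosedRange (OperatorSpectra.shift S z),
      ∀ z ∈ OperatorSpectra.piA S, ¬ ContinuousAt (OperatorSpectra.gamma S) z,
      OperatorSpectra.sigmaEA S ∩ OperatorSpectra.piA S = ∅,
      OperatorSpectra.piA S = OperatorSpectra.sigmaA S \ OperatorSpectra.sigmaAB S] :=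
  OperatorSpectra.aWeyl_tfae_of_sVEP (hT.of_quasiaffineTransform hST)
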